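/- There is a function $g:\mathbb{R}\to\mathbb{R}$ with $g(d)=o(d)$ as $d\to\infty$ such that the following holds. For every $m\ge 0$, every (not necessarily induced or spanning) subgraph $H$ of the hypercube $Q^m$ whose average degree $d=2e(H)/|V(H)|$ satisfies $d\ge 2$ contains a cycle of length at least $2^{d-g(d)}$. Here $Q^m$ is the graph on $\{0,1\}^m$ in which two vertices are adjacent when they differ in exactly one coordinate. (The function $g$ depends neither on $m$ nor on $H$.) -/

import Mathlib

open Asymptotics Filter

/-- The `m`-dimensional hypercube graph `Q^m`: the vertices are the 0/1-strings of length `m`,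
two of them being adjacent when they differ in exactly one coordinate. -/
def hypercubeGraph (m : ℕ) : SimpleGraph (Fin m → Bool) where
  Adj x y := hammingDist x y = 1
  symm := ⟨fun x y h => by rw [hammingDist_comm]; exact h⟩
  loopless := ⟨fun x h => by simp at h⟩

/-- The average degree `2 e(G) / |G|` of a finite graph `G`. -/
noncomputable def avgDegree {V : Type*} (G : SimpleGraph V) : ℝ :=
  2 * (G.edgeSet.ncard : ℝ) / (Nat.card V : ℝ)

/-! Let `k` be the length of a longest cycle. Depth-first search grows a path whose head is attached
to an unexplored set `A`; the neighbours of `A` outside it lie on the path. The set loses one vertex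
or splits at each step, so its size can be stopped between `k * t` and `2 * k * t`. A path vertex at
distance `i > 0` from the head and adjacent to `A` closes a cycle longer than `i`, so the first `k`
path vertices form a separator `B` with `t * |B| ≤ |A|` (`exists_separation`).

Every edge at `A` lies in `A ∪ B`, which by edge-isoperimetry (`card_interedges_le_mul_logb`) has
average degree at most `log₂ (k * (2 * t + 1))`. Deleting `A` and iterating gives `d ≤ (1 + 1 / t) *
log₂ (k * (2 * t + 1))`; taking `t = ⌈d⌉` yields `log₂ k ≥ d - O(log d)`. -/

namespace SimpleGraph

variable {V : Type*} {G : SimpleGraph V}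

/-! ### Small separators from depth-first search -/

/-- `x` reaches `y` by a walk all of whose vertices after the first lie in `A`. -/
def ReachesIn (G : SimpleGraph V) (A : Finset V) : V → V → Prop :=
  Relation.ReflTransGen fun x y => G.Adj x y ∧ y ∈ A

lemma ReachesIn.exists_isPath {A : Finset V} {v a : V} (h : G.ReachesIn A v a) :
    ∃ r : G.Walk v a, r.IsPath ∧ ∀ x ∈ r.support, x = v ∨ x ∈ A := by
  classical
  suffices ∃ r : G.Walk v a, ∀ x ∈ r.support, x = v ∨ x ∈ A by
    obtain ⟨r, hr⟩ := this
    exact ⟨r.bypass, r.bypass_isPath, fun x hx => hr x (r.support_bypass_subset_support hx)⟩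
  induction h with
  | refl => exact ⟨.nil, by simp⟩
  | tail _ h ih =>
    obtain ⟨r, hr⟩ := ih
    refine ⟨r.concat h.1, fun x hx => ?_⟩
    rw [Walk.support_concat, List.mem_append] at hx
    rcases hx with hx | hx
    · exact hr x hx
    · rw [List.mem_singleton.1 hx]
      exact .inr h.2

lemma ReachesIn.erase [DecidableEq V] {A : Finset V} {c a : V} (h : G.ReachesIn A c a) :
    G.ReachesIn (A.erase c) c a := by
  induction h with
  | refl => exact .refl
  | @tail b a _ h ih =>
    by_cases ha : a = c
    · rw [ha]; exact .refl
    · exact ih.tail ⟨h.1, Finset.mem_erase.2 ⟨ha, h.2⟩⟩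

/-- `A` is a union of connected components of `G[S]` minus the path `p`, each of which is
attached to the first vertex of `p`. -/
structure IsHanging (G : SimpleGraph V) (S A : Finset V) {v u : V} (p : G.Walk v u) : Prop where
  isPath : p.IsPath
  subset : A ⊆ S
  disjoint : ∀ x ∈ p.support, x ∉ A
  closed : ∀ a ∈ A, ∀ x ∈ S, G.Adj a x → x ∈ A ∨ x ∈ p.support
  reaches : ∀ a ∈ A, G.ReachesIn A v a

namespace IsHanging

variable {S A : Finset V} {v u : V} {p : G.Walk v u}

lemma exists_adj (h : G.IsHanging S A p) (hA : A.Nonempty) : ∃ c ∈ A, G.Adj v c := by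
  obtain ⟨a, ha⟩ := hA
  rcases (h.reaches a ha).cases_head with rfl | ⟨c, hc, -⟩
  · exact absurd ha (h.disjoint _ p.start_mem_support)
  · exact ⟨c, hc.2, hc.1⟩

/-- Closing up a path to `A` through an earlier vertex of `p` gives a long cycle. -/
lemma exists_isCycle (h : G.IsHanging S A p) {a w : V} (ha : a ∈ A) (hw : w ∈ p.support)
    (haw : G.Adj a w) : ∃ i, p.getVert i = w ∧
      (i = 0 ∨ ∃ (x : V) (c : G.Walk x x), c.IsCycle ∧ i < c.length) := by
  obtain ⟨i, rfl, hi⟩ := Walk.mem_support_iff_exists_getVert.1 hw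
  refine ⟨i, rfl, or_iff_not_imp_left.2 fun hi0 => ?_⟩
  obtain ⟨r, hr, hrs⟩ := (h.reaches a ha).exists_isPath
  have hv : v ∉ (p.take i).support.tail := by
    have := (h.isPath.take i).support_nodup
    rw [← Walk.cons_tail_support] at this
    exact (List.nodup_cons.1 this).1
  have hsub : ∀ x ∈ (p.take i).support, x ∈ p.support := fun x hx =>
    (p.isSubwalk_take i).support_subset hx
  have hlen : (p.take i).length = i := by rw [Walk.take_length]; omega
  have hwr : p.getVert i ∉ r.reverse.support := by
    rw [Walk.support_reverse, List.mem_reverse]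
    intro hx
    rcases hrs _ hx with hx | hx
    · have := h.isPath.getVert_injOn (by simpa using hi) (by simp) (hx.trans p.getVert_zero.symm)
      exact hi0 this
    · exact h.disjoint _ hw hx
  have hrl : r.length ≠ 0 := fun h0 => by
    have := Walk.eq_of_length_eq_zero h0
    exact h.disjoint _ p.start_mem_support (this ▸ ha)
  refine ⟨_, (p.take i).append (.cons haw.symm r.reverse),
    (h.isPath.take i).isCycle_append (hr.reverse.cons hwr) ?_ ?_, ?_⟩
  · intro x hx hx'
    rw [Walk.support_cons, List.tail_cons, Walk.support_reverse, List.mem_reverse] at hx'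
    rcases hrs x hx' with rfl | hxA
    · exact hv hx
    · exact h.disjoint x (hsub x (List.mem_of_mem_tail hx)) hxA
  · right
    simp only [Walk.length_cons, Walk.length_reverse]
    omega
  · simp only [Walk.length_append, Walk.length_cons, Walk.length_reverse, hlen]
    omega

/-- Either a hanging set splits into two, or the path extends into it. -/
lemma split [DecidableEq V] (h : G.IsHanging S A p) (hA : A.Nonempty) :
    (∃ C ⊆ A, C.Nonempty ∧ C ≠ A ∧ G.IsHanging S C p ∧ G.IsHanging S (A \ C) p) ∨
      ∃ c ∈ A, ∃ q : G.Walk c u, G.IsHanging S (A.erase c) q := by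
  classical
  obtain ⟨c, hcA, hvc⟩ := h.exists_adj hA
  have hvA : v ∉ A := h.disjoint v p.start_mem_support
  -- `C` is the component of `c` in `G[A]`. If it is all of `A`, then `c` can become the new head.
  set C := A.filter fun a => G.ReachesIn A c a with hC
  have hcC : c ∈ C := Finset.mem_filter.2 ⟨hcA, .refl⟩
  have hstep : ∀ {x y}, x ∈ C → y ∈ A → G.Adj x y → y ∈ C := fun hx hy hxy =>
    Finset.mem_filter.2 ⟨hy, (Finset.mem_filter.1 hx).2.tail ⟨hxy, hy⟩⟩
  by_cases hCA : C = A
  · right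
    refine ⟨c, hcA, .cons hvc.symm p, h.isPath.cons fun hc => h.disjoint c hc hcA,
      (Finset.erase_subset _ _).trans h.subset, ?_, ?_, ?_⟩
    · intro x hx
      rw [Walk.support_cons, List.mem_cons] at hx
      rcases hx with rfl | hx
      · simp
      · exact fun hxA => h.disjoint x hx (Finset.mem_of_mem_erase hxA)
    · intro a ha x hx hax
      rw [Walk.support_cons, List.mem_cons, Finset.mem_erase]
      have := h.closed a (Finset.mem_of_mem_erase ha) x hx hax
      tauto
    · intro a ha
      have : a ∈ C := hCA ▸ Finset.mem_of_mem_erase ha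
      exact (Finset.mem_filter.1 this).2.erase
  · left
    have hCs : C ⊆ A := Finset.filter_subset _ _
    refine ⟨C, hCs, ⟨c, hcC⟩, hCA, ⟨h.isPath, hCs.trans h.subset,
      fun x hx hxC => h.disjoint x hx (hCs hxC), ?_, ?_⟩, ⟨h.isPath,
      Finset.sdiff_subset.trans h.subset,
      fun x hx hxC => h.disjoint x hx (Finset.sdiff_subset hxC), ?_, ?_⟩⟩
    · intro a ha x hx hax
      exact (h.closed a (hCs ha) x hx hax).imp_left fun hxA => hstep ha hxA hax
    · intro a ha
      have key : ∀ b, G.ReachesIn A c b → b ∈ C ∧ G.ReachesIn C v b := fun b hb => by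
        induction hb with
        | refl => exact ⟨hcC, .single ⟨hvc, hcC⟩⟩
        | tail _ hxy ih =>
          have := hstep ih.1 hxy.2 hxy.1
          exact ⟨this, ih.2.tail ⟨hxy.1, this⟩⟩
      exact (key a (Finset.mem_filter.1 ha).2).2
    · intro a ha x hx hax
      have ha' := Finset.mem_sdiff.1 ha
      refine (h.closed a ha'.1 x hx hax).imp_left fun hxA => Finset.mem_sdiff.2 ⟨hxA, fun hxC => ?_⟩
      exact ha'.2 (hstep hxC ha'.1 hax.symm)
    · intro a ha
      have ha' := Finset.mem_sdiff.1 ha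
      have key : ∀ b, G.ReachesIn A v b → b ∉ C → G.ReachesIn (A \ C) v b := fun b hb => by
        induction hb with
        | refl => exact fun _ => .refl
        | tail _ hxy ih =>
          intro hb
          refine (ih fun hx => hb (hstep hx hxy.2 hxy.1)).tail
            ⟨hxy.1, Finset.mem_sdiff.2 ⟨hxy.2, hb⟩⟩
      exact key a (h.reaches a ha'.1) ha'.2

end IsHanging

/-- A hanging set of size at least `M` can be shrunk to size at most `2 * M`. -/
lemma exists_isHanging_card_le {S : Finset V} {M : ℕ} (hM : 0 < M) :
    ∀ {A : Finset V} {v u : V} {p : G.Walk v u}, G.IsHanging S A p → M ≤ A.card →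
      ∃ (A' : Finset V) (v' u' : V) (p' : G.Walk v' u'),
        G.IsHanging S A' p' ∧ M ≤ A'.card ∧ A'.card ≤ 2 * M := by
  classical
  intro A
  induction hn : A.card using Nat.strong_induction_on generalizing A with
  | _ n ih =>
  subst hn
  intro v u p h hMA
  by_cases h2 : A.card ≤ 2 * M
  · exact ⟨A, v, u, p, h, hMA, h2⟩
  rcases h.split (Finset.card_pos.1 (by omega)) with ⟨C, hCA, hC, hne, h₁, h₂⟩ | ⟨c, hc, q, hq⟩
  · have hlt := Finset.card_lt_card (hCA.ssubset_of_ne hne)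
    have hsum := Finset.card_sdiff_add_card_eq_card hCA
    have := hC.card_pos
    by_cases hCM : M ≤ C.card
    · exact ih _ hlt rfl h₁ hCM
    -- Here `|A| > 2 * M` and `|C| < M`, so the rest still has more than `M` vertices.
    · exact ih _ (by omega) rfl h₂ (by omega)
  · have := Finset.card_erase_add_one hc
    exact ih _ (by omega) rfl hq (by omega)

/-- In a graph without cycles longer than `k`, every nonempty vertex set `S` contains a
nonempty bounded set `A` cut off in `S` by a relatively small set `B`. -/
lemma exists_separation {k t : ℕ} (hk : 0 < k) (ht : 0 < t)
    (hc : ∀ (v : V) (c : G.Walk v v), c.IsCycle → c.length ≤ k) {S : Finset V} (hS : S.Nonempty) :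
    ∃ A B : Finset V, A ⊆ S ∧ A.Nonempty ∧ A.card ≤ 2 * (k * t) ∧ B.card ≤ k ∧
      t * B.card ≤ A.card ∧ ∀ a ∈ A, ∀ x ∈ S, G.Adj a x → x ∈ A ∨ x ∈ B := by
  classical
  obtain ⟨v, hv⟩ := hS
  have hkt : 0 < k * t := Nat.mul_pos hk ht
  set C := S.filter fun a => G.ReachesIn S v a with hC
  have hvC : v ∈ C := Finset.mem_filter.2 ⟨hv, .refl⟩
  have hstep : ∀ {x y}, x ∈ C → y ∈ S → G.Adj x y → y ∈ C := fun hx hy hxy =>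
    Finset.mem_filter.2 ⟨hy, (Finset.mem_filter.1 hx).2.tail ⟨hxy, hy⟩⟩
  by_cases hcard : C.card ≤ k * t
  -- A small component of `G[S]` needs no separator.
  · exact ⟨C, ∅, Finset.filter_subset _ _, ⟨v, hvC⟩, by omega, by simp, by simp,
      fun a ha x hx hax => .inl (hstep ha hx hax)⟩
  have hang : G.IsHanging S (C.erase v) (.nil : G.Walk v v) := by
    refine ⟨by simp, (Finset.erase_subset _ _).trans (Finset.filter_subset _ _), by simp, ?_, ?_⟩
    · intro a ha x hx hax
      have := hstep (Finset.mem_of_mem_erase ha) hx hax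
      by_cases hxv : x = v
      · simp [hxv]
      · exact .inl (Finset.mem_erase.2 ⟨hxv, this⟩)
    · intro a ha
      have key : ∀ b, G.ReachesIn S v b → b ∈ C ∧ G.ReachesIn C v b := fun b hb => by
        induction hb with
        | refl => exact ⟨hvC, .refl⟩
        | tail _ hxy ih =>
          have := hstep ih.1 hxy.2 hxy.1
          exact ⟨this, ih.2.tail ⟨hxy.1, this⟩⟩
      exact (key a (Finset.mem_filter.1 (Finset.mem_of_mem_erase ha)).2).2.erase
  obtain ⟨A, v', u', p, h, hl, hu⟩ := exists_isHanging_card_le hkt hang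
    (by have := Finset.card_erase_add_one hvC; omega)
  have hB : ((Finset.range k).image p.getVert).card ≤ k :=
    Finset.card_image_le.trans (Finset.card_range k).le
  refine ⟨A, (Finset.range k).image p.getVert, h.subset, Finset.card_pos.1 (by omega), hu, hB,
    ((Nat.mul_le_mul_left t hB).trans_eq (mul_comm t k)).trans hl, fun a ha x hx hax => ?_⟩
  refine (h.closed a ha x hx hax).imp_right fun hxp => ?_
  obtain ⟨i, rfl, hi⟩ := h.exists_isCycle ha hxp hax
  refine Finset.mem_image_of_mem _ (Finset.mem_range.2 ?_)
  rcases hi with rfl | ⟨y, c, hcyc, hlt⟩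
  · exact hk
  · exact hlt.trans_le (hc y c hcyc)

end SimpleGraph
-- Edge count by repeatedly deleting separated sets
namespace SimpleGraph

variable {V : Type*} {G : SimpleGraph V}

lemma card_interedges_le_of_separation [DecidableEq V] [DecidableRel G.Adj] {S A B : Finset V}
    (h : ∀ a ∈ A, ∀ x ∈ S, G.Adj a x → x ∈ A ∨ x ∈ B) :
    (G.interedges S S).card ≤ (G.interedges (S \ A) (S \ A)).card +
      (G.interedges (A ∪ B) (A ∪ B)).card := by
  refine (Finset.card_le_card fun e he => ?_).trans (Finset.card_union_le _ _)
  rw [mem_interedges_iff] at he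
  simp only [Finset.mem_union, mem_interedges_iff, Finset.mem_sdiff]
  have h₁ := h e.1
  have h₂ := h e.2
  have := he.2.2.symm
  grind

/-- If every vertex set of size `n` spans at most `n log₂ n / 2` edges and there are no cycles
longer than `k`, then the number of edges is bounded linearly. -/
lemma card_interedges_le_of_isCycle_length_le [DecidableEq V] [DecidableRel G.Adj]
    (hD : ∀ T : Finset V, ((G.interedges T T).card : ℝ) ≤ T.card * Real.logb 2 T.card)
    {k t : ℕ} (hk : 0 < k) (ht : 0 < t)
    (hc : ∀ (v : V) (c : G.Walk v v), c.IsCycle → c.length ≤ k) (S : Finset V) :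
    ((G.interedges S S).card : ℝ) ≤
      S.card * ((1 + 1 / t) * Real.logb 2 (k * (2 * t + 1))) := by
  induction S using Finset.strongInduction with
  | _ S ih =>
  rcases S.eq_empty_or_nonempty with rfl | hS
  · simp
  obtain ⟨A, B, hAS, hA, hA2, hBk, hBt, h⟩ := exists_separation hk ht hc hS
  have h₁ := ih _ (Finset.sdiff_ssubset hAS hA)
  have h₂ := hD (A ∪ B)
  have h₃ : ((G.interedges S S).card : ℝ) ≤ (G.interedges (S \ A) (S \ A)).card +
      (G.interedges (A ∪ B) (A ∪ B)).card := mod_cast card_interedges_le_of_separation h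
  have hcard : ((S \ A).card : ℝ) + A.card = S.card :=
    mod_cast Finset.card_sdiff_add_card_eq_card hAS
  have hAB : (A ∪ B).card ≤ A.card + B.card := Finset.card_union_le _ _
  have hpos : 0 < (A ∪ B).card := (hA.mono Finset.subset_union_left).card_pos
  have ht' : (0 : ℝ) < t := mod_cast ht
  have hABt : ((A ∪ B).card : ℝ) ≤ A.card * (1 + 1 / t) := by
    have hB : (B.card : ℝ) ≤ A.card / t := by
      rw [le_div_iff₀ ht', mul_comm]
      exact_mod_cast hBt
    calc ((A ∪ B).card : ℝ) ≤ A.card + B.card := mod_cast hAB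
      _ ≤ A.card + A.card / t := by gcongr
      _ = _ := by ring
  -- `2 * k * t` from `A` plus `k` from `B`.
  have hABk : ((A ∪ B).card : ℝ) ≤ k * (2 * t + 1) := by
    have : (A ∪ B).card ≤ k * (2 * t + 1) := by nlinarith
    exact_mod_cast this
  have hone : (1 : ℝ) ≤ (A ∪ B).card := mod_cast hpos
  have hlog : Real.logb 2 (A ∪ B).card ≤ Real.logb 2 (k * (2 * t + 1)) :=
    Real.logb_le_logb_of_le one_lt_two (by linarith) hABk
  have hlog0 : 0 ≤ Real.logb 2 (A ∪ B).card := Real.logb_nonneg one_lt_two hone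
  have h₄ : ((A ∪ B).card : ℝ) * Real.logb 2 (A ∪ B).card ≤
      A.card * (1 + 1 / t) * Real.logb 2 (k * (2 * t + 1)) := by gcongr
  rw [← hcard]
  linarith

end SimpleGraph

/-! ### Edge-isoperimetry in the hypercube -/

/-- By concavity, entropy lies above its chord from `0` to `1 / 2`. -/
lemma Real.two_mul_le_binEntropy {p : ℝ} (h0 : 0 ≤ p) (h1 : p ≤ 1 / 2) :
    2 * p * Real.log 2 ≤ Real.binEntropy p := by
  have := Real.strictConcave_binEntropy.concaveOn.2 (Set.left_mem_Icc.2 zero_le_one)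
    (show (2⁻¹ : ℝ) ∈ Set.Icc (0 : ℝ) 1 by norm_num)
    (show 0 ≤ 1 - 2 * p by linarith) (show 0 ≤ 2 * p by linarith) (by ring)
  simp only [Real.binEntropy_zero, Real.binEntropy_two_inv, smul_eq_mul, mul_zero, zero_add] at this
  rwa [show 2 * p * 2⁻¹ = p by ring] at this

/-- This is the entropy bound at `p = a / (a + b)`. It drives the induction on halves of a cube,
where `2 * a` pays for the crossing edges. -/
lemma Real.mul_logb_add_mul_logb_add_le {a b : ℝ} (ha : 0 < a) (hab : a ≤ b) :
    a * Real.logb 2 a + b * Real.logb 2 b + 2 * a ≤ (a + b) * Real.logb 2 (a + b) := by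
  have hb : 0 < b := ha.trans_le hab
  have hs : 0 < a + b := by linarith
  have h := Real.two_mul_le_binEntropy (p := a / (a + b)) (by positivity)
    (by rw [div_le_div_iff₀ hs two_pos]; linarith)
  have hq : 1 - a / (a + b) = b / (a + b) := by field_simp; ring
  rw [Real.binEntropy, hq, inv_div, inv_div, Real.log_div hs.ne' ha.ne',
    Real.log_div hs.ne' hb.ne'] at h
  have hl : 0 < Real.log 2 := Real.log_pos one_lt_two
  have h' := mul_le_mul_of_nonneg_left h hs.le
  field_simp at h'
  simp only [Real.logb]
  rw [← sub_nonneg]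
  have e : (a + b) * (Real.log (a + b) / Real.log 2) - (a * (Real.log a / Real.log 2) +
      b * (Real.log b / Real.log 2) + 2 * a) = ((a + b) * Real.log (a + b) - a * Real.log a -
      b * Real.log b - 2 * a * Real.log 2) / Real.log 2 := by
    field_simp; ring
  rw [e]
  apply div_nonneg _ hl.le
  linarith

lemma eq_of_hammingDist_eq_one_of_apply_ne {m : ℕ} {x y z : Fin m → Bool} {i : Fin m}
    (hy : hammingDist x y = 1) (hz : hammingDist x z = 1) (hyi : x i ≠ y i) (hzi : x i ≠ z i) :
    y = z := by
  have key : ∀ w : Fin m → Bool, hammingDist x w = 1 → x i ≠ w i → ∀ j, j ≠ i → x j = w j := by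
    intro w hw hwi j hj
    by_contra hne
    exact hj (Finset.card_le_one.1 hw.le j (by simpa using hne) i (by simpa using hwi))
  funext j
  by_cases hj : j = i
  · subst hj
    revert hyi hzi
    cases x j <;> cases y j <;> cases z j <;> simp
  · rw [← key y hy hyi j hj, ← key z hz hzi j hj]

/-- The edge-isoperimetric inequality for subgraphs of the hypercube. -/
lemma SimpleGraph.card_interedges_le_mul_logb {V : Type*} [DecidableEq V] {G : SimpleGraph V}
    [DecidableRel G.Adj] {m : ℕ} {f : V → Fin m → Bool} (hf : Function.Injective f)
    (hG : ∀ x y, G.Adj x y → hammingDist (f x) (f y) = 1) (T : Finset V) :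
    ((G.interedges T T).card : ℝ) ≤ T.card * Real.logb 2 T.card := by
  induction T using Finset.strongInduction with
  | _ T ih =>
  by_cases hT : T.card ≤ 1
  · have : G.interedges T T = ∅ := by
      ext e
      simp only [mem_interedges_iff, Finset.notMem_empty, iff_false, not_and]
      intro h1 h2 h3
      exact h3.ne (Finset.card_le_one.1 hT _ h1 _ h2)
    rw [this]
    rcases Nat.le_one_iff_eq_zero_or_eq_one.1 hT with h | h <;> simp [h]
  obtain ⟨x, hx, y, hy, hxy⟩ := Finset.one_lt_card.1 (not_le.1 hT)
  obtain ⟨i, hi⟩ := Function.ne_iff.1 (hf.ne hxy)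
  have split : ∀ c : Bool, (∃ z ∈ T, f z i = c) → (∃ z ∈ T, f z i ≠ c) →
      (T.filter (f · i = c)).card ≤ (T.filter (f · i ≠ c)).card →
      ((G.interedges T T).card : ℝ) ≤ T.card * Real.logb 2 T.card := by
    rintro c ⟨z, hz, hzc⟩ ⟨w, hw, hwc⟩ hle
    set P := T.filter (f · i = c) with hP
    set Q := T.filter (f · i ≠ c) with hQ
    have h₁ := ih P (Finset.filter_ssubset.2 ⟨w, hw, hwc⟩)
    have h₂ := ih Q (Finset.filter_ssubset.2 ⟨z, hz, by simpa using hzc⟩)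
    have hcard : P.card + Q.card = T.card := Finset.card_filter_add_card_filter_not _
    -- Flipping coordinate `i` is the only way across, so each vertex of the smaller half `P` has at
    -- most one neighbour in `Q`.
    have hPQ : (G.interedges P Q).card ≤ P.card := by
      refine Finset.card_le_card_of_injOn Prod.fst
        (fun e he => (G.mem_interedges_iff.1 he).1) ?_
      intro e he e' he' hee
      simp only [Finset.mem_coe, mem_interedges_iff, hP, hQ, Finset.mem_filter] at he he'
      refine Prod.ext hee (hf (eq_of_hammingDist_eq_one_of_apply_ne (i := i)
        (hG _ _ he.2.2) (hee ▸ hG _ _ he'.2.2) ?_ ?_))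
      · rw [he.1.2]; exact he.2.1.2.symm
      · rw [he.1.2]; exact he'.2.1.2.symm
    have hQP : (G.interedges Q P).card = (G.interedges P Q).card :=
      haveI : Std.Symm G.Adj := G.symm
      Rel.card_interedges_comm Q P
    have hunion : (G.interedges T T).card ≤ (G.interedges P P).card + (G.interedges Q Q).card +
        ((G.interedges P Q).card + (G.interedges Q P).card) := by
      refine (Finset.card_le_card (t := (G.interedges P P ∪ G.interedges Q Q) ∪
        (G.interedges P Q ∪ G.interedges Q P)) fun e he => ?_).trans
        ((Finset.card_union_le _ _).trans
          (add_le_add (Finset.card_union_le _ _) (Finset.card_union_le _ _)))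
      simp only [mem_interedges_iff, Finset.mem_union, hP, hQ, Finset.mem_filter] at he ⊢
      tauto
    have hP0 : 0 < P.card := Finset.card_pos.2 ⟨z, Finset.mem_filter.2 ⟨hz, hzc⟩⟩
    have key := Real.mul_logb_add_mul_logb_add_le (a := P.card) (b := Q.card)
      (mod_cast hP0) (mod_cast hle)
    have hfin : (G.interedges T T).card ≤ (G.interedges P P).card + (G.interedges Q Q).card +
        2 * P.card := by omega
    have hfin' : ((G.interedges T T).card : ℝ) ≤ (G.interedges P P).card +
        (G.interedges Q Q).card + 2 * P.card := mod_cast hfin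
    have hcard' : (P.card : ℝ) + Q.card = T.card := mod_cast hcard
    rw [hcard'] at key
    linarith
  rcases le_total (T.filter (f · i = f x i)).card (T.filter (f · i ≠ f x i)).card with h | h
  · exact split (f x i) ⟨x, hx, rfl⟩ ⟨y, hy, hi.symm⟩ h
  · have e₁ : ∀ z, f z i = !f x i ↔ f z i ≠ f x i := fun z => by
      cases f z i <;> cases f x i <;> simp
    have e₂ : ∀ z, f z i ≠ !f x i ↔ f z i = f x i := fun z => by
      cases f z i <;> cases f x i <;> simp
    refine split (!f x i) ⟨y, hy, (e₁ y).2 hi.symm⟩ ⟨x, hx, (e₂ x).2 rfl⟩ ?_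
    simpa only [e₁, e₂] using h

/-! ### Longest cycles, asymptotics and conclusion -/

lemma SimpleGraph.IsAcyclic.card_edgeFinset_lt {V : Type*} [Fintype V] [Nonempty V]
    {G : SimpleGraph V} [Fintype G.edgeSet] (h : G.IsAcyclic) :
    G.edgeFinset.card < Fintype.card V := by
  classical
  obtain ⟨F, hGF, -, hF⟩ := connected_top.exists_isTree_le_of_le_of_isAcyclic le_top h
  have h₁ := hF.card_edgeFinset
  have h₂ : G.edgeFinset.card ≤ F.edgeFinset.card := Finset.card_le_card (by simpa using hGF)
  omega

lemma SimpleGraph.exists_isCycle_forall_length_le {V : Type*} [Fintype V] {G : SimpleGraph V}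
    (h : ¬ G.IsAcyclic) : ∃ (v : V) (c : G.Walk v v), c.IsCycle ∧
      ∀ (w : V) (c' : G.Walk w w), c'.IsCycle → c'.length ≤ c.length := by
  let L : Set ℕ := {n | ∃ (v : V) (c : G.Walk v v), c.IsCycle ∧ c.length = n}
  have hL : L.Nonempty := by
    simp only [IsAcyclic, not_forall, not_not] at h
    obtain ⟨v, c, hc⟩ := h
    exact ⟨_, v, c, hc, rfl⟩
  have hbdd : BddAbove L := by
    refine ⟨Fintype.card V, ?_⟩
    rintro _ ⟨v, c, hc, rfl⟩
    have := hc.support_nodup.length_le_card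
    simpa using this
  obtain ⟨v, c, hc, hlen⟩ := Nat.sSup_mem hL hbdd
  exact ⟨v, c, hc, fun w c' hc' => hlen ▸ le_csSup hbdd ⟨w, c', hc', rfl⟩⟩

lemma isLittleO_one_add_logb :
    (fun d : ℝ => 1 + Real.logb 2 (2 * d + 3)) =o[atTop] (fun d : ℝ => d) := by
  refine IsLittleO.add (isLittleO_const_id_atTop 1) ?_
  have hlin : Tendsto (fun d : ℝ => 2 * d + 3) atTop atTop :=
    tendsto_atTop_add_const_right _ _ (tendsto_id.const_mul_atTop two_pos)
  have h₁ : (fun d : ℝ => Real.log (2 * d + 3)) =o[atTop] (fun d : ℝ => 2 * d + 3) :=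
    Real.isLittleO_log_id_atTop.comp_tendsto hlin
  have h₂ : (fun d : ℝ => 2 * d + 3) =O[atTop] (fun d : ℝ => d) :=
    ((isBigO_refl _ _).const_mul_left 2).add (isLittleO_const_id_atTop 3).isBigO
  have h₃ := (h₁.trans_isBigO h₂).const_mul_left (Real.log 2)⁻¹
  refine h₃.congr_left fun d => ?_
  rw [Real.logb, div_eq_inv_mul]

lemma sub_one_add_logb_le {d k : ℝ} {t : ℕ} (hk : 0 < k) (hdt : d ≤ t)
    (htd : t ≤ d + 1) (ht : 0 < t) (h : d ≤ (1 + 1 / t) * Real.logb 2 (k * (2 * t + 1))) :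
    d - (1 + Real.logb 2 (2 * d + 3)) ≤ Real.logb 2 k := by
  have ht' : (0 : ℝ) < t := mod_cast ht
  rw [Real.logb_mul hk.ne' (by positivity)] at h
  have hlog : Real.logb 2 (2 * t + 1) ≤ Real.logb 2 (2 * d + 3) :=
    Real.logb_le_logb_of_le one_lt_two (by positivity) (by linarith)
  set x := Real.logb 2 k + Real.logb 2 (2 * t + 1)
  suffices d - 1 ≤ x by linarith
  -- If `x < d - 1`, then `x < t`, so the factor `1 + 1 / t` adds less than `1` to `x` and cannot
  -- reach `d`.
  by_contra! hx
  have : (1 + 1 / (t : ℝ)) * x = x + x / t := by ring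
  have h1 : x / t < 1 := by rw [div_lt_one ht']; linarith
  linarith

theorem corollary1p6 :
    ∃ g : ℝ → ℝ, g =o[atTop] (fun d : ℝ => d) ∧
      ∀ (m : ℕ) (H : (hypercubeGraph m).Subgraph) (d : ℝ),
        avgDegree H.coe = d → 2 ≤ d →
          ∃ (v : H.verts) (c : H.coe.Walk v v),
            c.IsCycle ∧ (2 : ℝ) ^ (d - g d) ≤ (c.length : ℝ) := by
  classical
  refine ⟨_, isLittleO_one_add_logb, fun m H d hd hd2 => ?_⟩
  rcases isEmpty_or_nonempty H.verts with hV | hV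
  · simp only [avgDegree, Nat.card_of_isEmpty, Nat.cast_zero, div_zero] at hd
    linarith
  have hn : (0 : ℝ) < Fintype.card H.verts := mod_cast Fintype.card_pos
  have hdeg : 2 * (H.coe.edgeFinset.card : ℝ) = Fintype.card H.verts * d := by
    rw [← hd, avgDegree, Nat.card_eq_fintype_card, Set.ncard_eq_toFinset_card',
      SimpleGraph.edgeFinset]
    field_simp
  -- A forest has average degree below `2`; this is where `2 ≤ d` provides a cycle.
  have hcyc : ¬ H.coe.IsAcyclic := fun h => by
    have : (H.coe.edgeFinset.card : ℝ) < Fintype.card H.verts := mod_cast h.card_edgeFinset_lt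
    nlinarith
  obtain ⟨v, c, hc, hmax⟩ := SimpleGraph.exists_isCycle_forall_length_le hcyc
  refine ⟨v, c, hc, ?_⟩
  have hk : 0 < c.length := by have := hc.three_le_length; omega
  have ht : 0 < ⌈d⌉₊ := Nat.ceil_pos.2 (by linarith)
  have hbound := SimpleGraph.card_interedges_le_of_isCycle_length_le
    (SimpleGraph.card_interedges_le_mul_logb (G := H.coe) Subtype.val_injective
      fun x y hxy => H.adj_sub hxy) hk ht hmax Finset.univ
  have hedges : (H.coe.interedges Finset.univ Finset.univ).card = 2 * H.coe.edgeFinset.card := by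
    rw [SimpleGraph.two_mul_card_edgeFinset, SimpleGraph.interedges_def, Finset.univ_product_univ]
  rw [hedges, Nat.cast_mul, Nat.cast_two, hdeg, Finset.card_univ] at hbound
  have hk' : (0 : ℝ) < c.length := mod_cast hk
  have := sub_one_add_logb_le hk' (Nat.le_ceil d)
    (Nat.ceil_lt_add_one (by linarith)).le ht (le_of_mul_le_mul_left hbound hn)
  rwa [← Real.le_logb_iff_rpow_le one_lt_two hk']
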